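/- Let $\mathcal X\subseteq\{0,1\}^d$, $w\in\mathbb R^d$, $A\in\mathbb R^{m\times n}$, and for $\xi\in\mathbb R^k$ and $x\in\mathcal X$ let $c(\xi)=C\xi+c_0\in\mathbb R^n$, $v(\xi)=V\xi+v_0\in\mathbb R^n$ and $b_x(\xi)=\sum_{i=1}^d x_i(B_i\xi+b_i)+B_0\xi+b_0\in\mathbb R^m$. Let $\xi^1,\dots,\xi^N\in\mathbb R^k$ be scenarios, $\mu_0\in\mathbb R^k$, $\Sigma_0\in\mathbb R^{k\times k}$ symmetric positive definite, $\gamma_1\ge 0$, $\gamma_2\ge 1$, and let $$\mathcal D_{\rm dis}=\Big\{\pi\in\mathbb R^N_+:\ \textstyle\sum_s\pi_s=1,\ \big(\sum_s\pi_s\xi^s-\mu_0\big)^\top\Sigma_0^{-1}\big(\sum_s\pi_s\xi^s-\mu_0\big)\le\gamma_1,\ \sum_s\pi_s(\xi^s-\mu_0)(\xi^s-\mu_0)^\top\preceq\gamma_2\Sigma_0\Big\}.$$ Assume relatively complete recourse: for every $x\in\mathcal X$ and every $s$, the set $\{y\in\mathbb R^n: Ay\le b_x(\xi^s)\}$ is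 nonempty and bounded. Put $\Omega(x,\xi)=\arg\min_y\{c(\xi)^\top y: Ay\le b_x(\xi)\}$ and $\Psi(x,\xi)=\max_{y\in\Omega(x,\xi)}v(\xi)^\top y$ (the maximum is attained for every $x\in\mathcal X$ and $\xi=\xi^s$), and consider the pessimistic bilevel program $$(\mathcal P)\qquad \min_{x\in\mathcal X}\ w^\top x+\sup_{\pi\in\mathcal D_{\rm dis}}\sum_{s=1}^N\pi_s\Psi(x,\xi^s).$$ For $M>0$ consider the 0-1 SDP in the variables $x\in\mathcal X$, $Q\in\mathbb R^{k\times k}$ symmetric, $q\in\mathbb R^k$, $r,t,\lambda\in\mathbb R$, $\theta\in\mathbb R^d$, $p^s,\omega_i^s\in\mathbb R^m$, $y^s\in\mathbb R^n$: $$\begin{aligned}\min\ & w^\top x+r+t\\ \text{s.t. } & r\ge\textstyle\sum_{i=1}^d(B_i\xi^s+b_i)^\top\omega_i^s+(B_0\xi^s+b_0)^\top p^s+c(\xi^s)^\top y^s-(\xi^s)^\top Q\xi^s-(\xi^s)^\top q,\quad s=1,\dots,N,\\ & A^\top p^s+\lambda c(\xi^s)=v(\xi^s),\quad Ay^s\le\textstyle\sum_{i=1}^d\theta_i(B_i\xi^s+b_i)+\lambda(B_0\xi^s+b_0),\quad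 s=1,\dots,N,\\ & t\ge(\gamma_2\Sigma_0+\mu_0\mu_0^\top)\cdot Q+\mu_0^\top q+\sqrt{\gamma_1}\,\big\|\Sigma_0^{1/2}(q+2Q\mu_0)\big\|_2,\\ & p^s-(1-x_i)M\mathbf 1_m\le\omega_i^s\le p^s+(1-x_i)M\mathbf 1_m,\quad -x_iM\mathbf 1_m\le\omega_i^s\le x_iM\mathbf 1_m,\quad i=1,\dots,d,\ s=1,\dots,N,\\ & \lambda-M(1-x_i)\le\theta_i\le Mx_i,\quad 0\le\theta_i\le\lambda,\quad i=1,\dots,d,\\ & Q\succeq 0,\quad \lambda\ge 0,\quad p^s\ge 0,\quad s=1,\dots,N.\end{aligned}$$ Then this 0-1 SDP is equivalent to $(\mathcal P)$ for all sufficiently large $M$. That is, there is $M_0>0$ (depending on the data) such that for every $M\ge M_0$: (i) for every $x\in\mathcal X$, the infimum of the SDP with $x$ fixed equals $w^\top x+\sup_{\pi\in\mathcal D_{\rm dis}}\sum_s\pi_s\Psi(x,\xi^s)$, and the optimal values (infima) of the SDP and of $(\mathcal P)$ are equal, all as extended real numbers; (ii) the $x$-component of every optimal solution of the SDP is optimal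 for $(\mathcal P)$; (iii) if some probability vector $\pi$ satisfies $\sum_s\pi_s(\xi^s-\mu_0)(\xi^s-\mu_0)^\top\prec\gamma_2\Sigma_0$ and, with $\bar\xi=\sum_s\pi_s\xi^s$, either $(\bar\xi-\mu_0)^\top\Sigma_0^{-1}(\bar\xi-\mu_0)<\gamma_1$ or $\bar\xi=\mu_0$, then every optimal $x$ of $(\mathcal P)$ extends to an optimal solution of the SDP. The condition in (iii) holds whenever $N\ge 2$, $\mu_0=\frac1N\sum_s\xi^s$ and $\Sigma_0=\frac1{N-1}\sum_s(\xi^s-\mu_0)(\xi^s-\mu_0)^\top$. -/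

import Mathlib

open Matrix
open scoped MatrixOrder

noncomputable section

/-- The data of a pessimistic distributionally robust bilevel program with `d` binary leader
variables, a random vector in `ℝ^k`, `m` follower constraints, `n` follower variables and `N`
scenarios. The fields `B0, B, b0, b` describe the right-hand side
`b_x(ξ) = (∑ i, x i • B i + B0) ξ + (∑ i, x i • b i + b0)`, and
`c(ξ) = C ξ + c0`, `v(ξ) = V ξ + v0`. -/
structure BilevelData (d k m n N : ℕ) where
  /-- the leader's feasible region -/
  X : Set (Fin d → ℝ)
  w : Fin d → ℝ
  A : Matrix (Fin m) (Fin n) ℝ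
  B0 : Matrix (Fin m) (Fin k) ℝ
  B : Fin d → Matrix (Fin m) (Fin k) ℝ
  b0 : Fin m → ℝ
  b : Fin d → Fin m → ℝ
  C : Matrix (Fin n) (Fin k) ℝ
  c0 : Fin n → ℝ
  V : Matrix (Fin n) (Fin k) ℝ
  v0 : Fin n → ℝ
  /-- the scenarios -/
  ξ : Fin N → Fin k → ℝ
  /-- the mean estimate `μ₀` -/
  μ0 : Fin k → ℝ
  /-- the covariance estimate `Σ₀` -/
  S0 : Matrix (Fin k) (Fin k) ℝ
  γ1 : ℝ
  γ2 : ℝ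

namespace BilevelData

variable {d k m n N : ℕ} (I : BilevelData d k m n N)

/-- `c(ξ) = C ξ + c0`. -/
def cost (z : Fin k → ℝ) : Fin n → ℝ := I.C *ᵥ z + I.c0

/-- `v(ξ) = V ξ + v0`. -/
def leaderCost (z : Fin k → ℝ) : Fin n → ℝ := I.V *ᵥ z + I.v0

/-- `b_x(ξ) = B_x ξ + b_{x0}`. -/
def rhs (x : Fin d → ℝ) (z : Fin k → ℝ) : Fin m → ℝ :=
  (∑ i, x i • I.B i + I.B0) *ᵥ z + (∑ i, x i • I.b i + I.b0)

/-- The follower's feasible region `{y | A y ≤ b_x(ξ)}`. -/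
def followerSet (x : Fin d → ℝ) (z : Fin k → ℝ) : Set (Fin n → ℝ) :=
  {y | I.A *ᵥ y ≤ I.rhs x z}

/-- `Ω(x, ξ)`, the set of optimal solutions of the follower. -/
def Ω (x : Fin d → ℝ) (z : Fin k → ℝ) : Set (Fin n → ℝ) :=
  {y | y ∈ I.followerSet x z ∧ ∀ y' ∈ I.followerSet x z, I.cost z ⬝ᵥ y ≤ I.cost z ⬝ᵥ y'}

/-- `Ψ(x, ξ) = max_{y ∈ Ω(x, ξ)} v(ξ)ᵀ y`. -/
def Ψ (x : Fin d → ℝ) (z : Fin k → ℝ) : ℝ :=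
  sSup ((fun y => I.leaderCost z ⬝ᵥ y) '' I.Ω x z)

/-- The mean of the discrete distribution with weights `p`. -/
def mean (p : Fin N → ℝ) : Fin k → ℝ := ∑ s, p s • I.ξ s

/-- The second moment matrix about `μ0` of the discrete distribution with weights `p`. -/
def secondMoment (p : Fin N → ℝ) : Matrix (Fin k) (Fin k) ℝ :=
  ∑ s, p s • vecMulVec (I.ξ s - I.μ0) (I.ξ s - I.μ0)

/-- The moment ambiguity set of discrete distributions. -/
def ambiguitySet : Set (Fin N → ℝ) :=
  {p | 0 ≤ p ∧ ∑ s, p s = 1 ∧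
    (I.mean p - I.μ0) ⬝ᵥ (I.S0⁻¹ *ᵥ (I.mean p - I.μ0)) ≤ I.γ1 ∧
    (I.γ2 • I.S0 - I.secondMoment p).PosSemidef}

/-- The objective of the pessimistic program at `x`:
`wᵀ x + sup_{p ∈ D} ∑ s, p s * Ψ(x, ξ^s)` (equal to `-∞` if `D` is empty). -/
def pessObjective (x : Fin d → ℝ) : EReal :=
  ((I.w ⬝ᵥ x : ℝ) : EReal) + ⨆ p ∈ I.ambiguitySet, ((∑ s, p s * I.Ψ x (I.ξ s) : ℝ) : EReal)

/-- The optimal value of the pessimistic program. -/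
def pessValue : EReal := ⨅ x ∈ I.X, I.pessObjective x

/-- `x` is an optimal leader's decision of the pessimistic program. -/
def IsPessOptimal (x : Fin d → ℝ) : Prop :=
  x ∈ I.X ∧ ∀ x' ∈ I.X, I.pessObjective x ≤ I.pessObjective x'

/-- Relatively complete recourse: in every scenario and for every decision of the leader, the
follower's feasible region is nonempty and bounded. -/
def CompleteRecourse : Prop :=
  ∀ x ∈ I.X, ∀ s, (I.followerSet x (I.ξ s)).Nonempty ∧
    Bornology.IsBounded (I.followerSet x (I.ξ s))

/-- `μ0` and `S0` are the sample mean and the sample covariance of the scenarios. -/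
def IsEmpirical : Prop :=
  2 ≤ N ∧ I.μ0 = (1 / (N : ℝ)) • ∑ s, I.ξ s ∧
    I.S0 = (1 / ((N : ℝ) - 1)) • ∑ s, vecMulVec (I.ξ s - I.μ0) (I.ξ s - I.μ0)

/-- The ambiguity set satisfies Slater's condition: some distribution satisfies the second moment
constraint strictly, and the first moment constraint strictly or with mean exactly `μ0`. -/
def StrictlyFeasible : Prop :=
  ∃ p : Fin N → ℝ, 0 ≤ p ∧ ∑ s, p s = 1 ∧
    ((I.mean p - I.μ0) ⬝ᵥ (I.S0⁻¹ *ᵥ (I.mean p - I.μ0)) < I.γ1 ∨ I.mean p = I.μ0) ∧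
    (I.γ2 • I.S0 - I.secondMoment p).PosDef

end BilevelData

/-- The continuous variables of the 0-1 semidefinite program. -/
structure SDPVars (d k m n N : ℕ) where
  Q : Matrix (Fin k) (Fin k) ℝ
  q : Fin k → ℝ
  r : ℝ
  t : ℝ
  lam : ℝ
  p : Fin N → Fin m → ℝ
  y : Fin N → Fin n → ℝ
  θ : Fin d → ℝ
  ω : Fin d → Fin N → Fin m → ℝ

namespace BilevelData

variable {d k m n N : ℕ} (I : BilevelData d k m n N)

/-- The constraints of the 0-1 semidefinite program with big-M constant `M`. -/
structure SDPFeasible (M : ℝ) (x : Fin d → ℝ) (z : SDPVars d k m n N) : Prop where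
  x_mem : x ∈ I.X
  epigraph : ∀ s, ∑ i, (I.B i *ᵥ I.ξ s + I.b i) ⬝ᵥ z.ω i s + (I.B0 *ᵥ I.ξ s + I.b0) ⬝ᵥ z.p s
    + I.cost (I.ξ s) ⬝ᵥ z.y s - I.ξ s ⬝ᵥ (z.Q *ᵥ I.ξ s) - I.ξ s ⬝ᵥ z.q ≤ z.r
  dual_eq : ∀ s, I.Aᵀ *ᵥ z.p s + z.lam • I.cost (I.ξ s) = I.leaderCost (I.ξ s)
  primal_le : ∀ s, I.A *ᵥ z.y s ≤
    ∑ i, z.θ i • (I.B i *ᵥ I.ξ s + I.b i) + z.lam • (I.B0 *ᵥ I.ξ s + I.b0)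
  moment : trace ((I.γ2 • I.S0 + vecMulVec I.μ0 I.μ0)ᵀ * z.Q) + I.μ0 ⬝ᵥ z.q
    + Real.sqrt I.γ1 *
      ‖WithLp.toLp 2 (CFC.sqrt I.S0 *ᵥ (z.q + (2 : ℝ) • (z.Q *ᵥ I.μ0)))‖ ≤ z.t
  ω_le : ∀ i s j, z.ω i s j ≤ z.p s j + (1 - x i) * M
  le_ω : ∀ i s j, z.p s j - (1 - x i) * M ≤ z.ω i s j
  neg_le_ω : ∀ i s j, -(x i * M) ≤ z.ω i s j
  ω_le_mul : ∀ i s j, z.ω i s j ≤ x i * M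
  θ_le_mul : ∀ i, z.θ i ≤ M * x i
  le_θ : ∀ i, z.lam - M * (1 - x i) ≤ z.θ i
  θ_nonneg : ∀ i, 0 ≤ z.θ i
  θ_le_lam : ∀ i, z.θ i ≤ z.lam
  Q_psd : z.Q.PosSemidef
  lam_nonneg : 0 ≤ z.lam
  p_nonneg : ∀ s, 0 ≤ z.p s

/-- The objective `wᵀ x + r + t` of the 0-1 semidefinite program. -/
def sdpObjective (x : Fin d → ℝ) (z : SDPVars d k m n N) : ℝ := I.w ⬝ᵥ x + z.r + z.t

/-- The optimal value of the 0-1 semidefinite program with the leader's decision fixed to `x`. -/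
def sdpValueAt (M : ℝ) (x : Fin d → ℝ) : EReal :=
  ⨅ (z : SDPVars d k m n N) (_ : I.SDPFeasible M x z), (I.sdpObjective x z : EReal)

/-- The optimal value of the 0-1 semidefinite program. -/
def sdpValue (M : ℝ) : EReal :=
  ⨅ (x : Fin d → ℝ) (z : SDPVars d k m n N) (_ : I.SDPFeasible M x z),
    (I.sdpObjective x z : EReal)

/-- `(x, z)` is an optimal solution of the 0-1 semidefinite program. -/
def IsSDPOptimal (M : ℝ) (x : Fin d → ℝ) (z : SDPVars d k m n N) : Prop :=
  I.SDPFeasible M x z ∧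
    ∀ x' z', I.SDPFeasible M x' z' → I.sdpObjective x z ≤ I.sdpObjective x' z'

end BilevelData

end

/-!
For a fixed leader's decision `x`, the semidefinite program is the result of two dualizations.

The follower. `Ψ x ξ` is the optimal value of the linear program `max v ⬝ᵥ y` over `A *ᵥ y ≤ b`,
`c ⬝ᵥ y ≤ φ`, where `φ` is the follower's optimal value. Its dual has variables `p` and `lam`, and
`lam * φ` is the minimum of `c ⬝ᵥ y` over `A *ᵥ y ≤ lam • b`. Weak duality is
`BilevelData.Ψ_le_of_multipliers`. For strong duality (`BilevelData.exists_multipliers`, from Farkas'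
lemma) an optimal dual solution exists for every sufficiently large `lam`, because a dual solution of
the follower's own problem pays for an increase of `lam`; so a single `lam` serves all scenarios. As
`x` is binary, the big-M constraints say exactly that `θ i = x i * lam` and `ω i s = x i • p s`, once
`M` exceeds the components of the chosen dual solutions. These depend only on `x`, which has finitely
many values.

The moments. After centring the scenarios at `μ0` and substituting `u = q + 2 Q μ0`, what remains
is the Lagrangian dual of `sup_{p ∈ D} ∑ s, p s * ψ s` with `ψ = Ψ x` (`BilevelData.IsDualBound`).
The duality gap is zero without a constraint qualification because the probability simplex is
compact; concretely, separating a convex set from an open orthant of `ℝ^N` produces the distribution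
(`BilevelData.exists_isDualBound_of_forall_lt`). This covers an empty ambiguity set, where both values
are `-∞`.

Attainment. At a Slater point `p` the Lagrangian bounds `Q`, and, if the mean constraint is strict,
also `u`. If `mean p = μ0` and `γ1 = 0`, then `u` may be unbounded, but it enters linearly, and
Farkas' lemma eliminates it at the cost of closed conditions on the remaining bounded variables.
-/

noncomputable section

/-! ### Farkas' lemma and linear programming duality -/

/-- **Farkas' lemma** for finitely many linear functionals. The induction removes one functional
`a i` at a time: either it is redundant, or there is a point `y₀` with `a i y₀ = 1` that violates
the implication without it, and one passes to the kernel of `a i` along `y₀`. -/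
theorem farkas_finset {V ι : Type*} [AddCommGroup V] [Module ℝ V] (s : Finset ι) :
    ∀ (a : ι → V →ₗ[ℝ] ℝ) (g : V →ₗ[ℝ] ℝ), (∀ y, (∀ i ∈ s, a i y ≤ 0) → g y ≤ 0) →
      ∃ p : ι → ℝ, (∀ i, 0 ≤ p i) ∧ g = ∑ i ∈ s, p i • a i := by
  classical
  induction s using Finset.induction_on with
  | empty =>
    intro a g h
    refine ⟨0, fun _ => le_rfl, ?_⟩
    ext y
    have h1 := h y (by simp)
    have h2 := h (-y) (by simp)
    simp only [map_neg] at h2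
    simp only [Finset.sum_empty, LinearMap.zero_apply]
    linarith
  | insert j s hj ih =>
    intro a g h
    by_cases hred : ∀ y, (∀ i ∈ s, a i y ≤ 0) → g y ≤ 0
    · obtain ⟨p, hp, hg⟩ := ih a g hred
      refine ⟨Function.update p j 0, fun i => ?_, ?_⟩
      · by_cases hi : i = j
        · subst hi; simp
        · simp [hi, hp i]
      · rw [Finset.sum_insert hj, hg]
        simp only [Function.update_self, zero_smul, zero_add]
        refine Finset.sum_congr rfl fun i hi => ?_
        rw [Function.update_of_ne (ne_of_mem_of_not_mem hi hj)]
    · push Not at hred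
      obtain ⟨y₁, hy₁, hgy₁⟩ := hred
      have haj : 0 < a j y₁ := by
        by_contra hcon
        exact absurd (h y₁ (by
          intro i hi
          rcases Finset.mem_insert.1 hi with rfl | hi
          · exact not_lt.1 hcon
          · exact hy₁ i hi)) (not_le.2 hgy₁)
      set y₀ := (a j y₁)⁻¹ • y₁ with hy₀
      have e1 : a j y₀ = 1 := by simp [hy₀, haj.ne']
      have e2 : ∀ i ∈ s, a i y₀ ≤ 0 := fun i hi => by
        simp only [hy₀, map_smul, smul_eq_mul]
        exact mul_nonpos_of_nonneg_of_nonpos (inv_nonneg.2 haj.le) (hy₁ i hi)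
      have e3 : 0 < g y₀ := by
        simp only [hy₀, map_smul, smul_eq_mul]; positivity
      obtain ⟨p, hp, hg⟩ := ih (fun i => a i - (a i y₀) • a j) (g - (g y₀) • a j) (by
        intro y hy
        have := h (y - (a j y) • y₀) (by
          intro i hi
          rcases Finset.mem_insert.1 hi with rfl | hi
          · simp [e1]
          · have := hy i hi
            simp only [LinearMap.sub_apply, LinearMap.smul_apply, smul_eq_mul] at this
            simp only [map_sub, map_smul, smul_eq_mul]
            linarith)
        simp only [map_sub, map_smul, smul_eq_mul] at this
        simp only [LinearMap.sub_apply, LinearMap.smul_apply, smul_eq_mul]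
        linarith)
      refine ⟨Function.update p j (g y₀ - ∑ i ∈ s, p i * a i y₀), fun i => ?_, ?_⟩
      · by_cases hi : i = j
        · subst hi
          have : ∑ i ∈ s, p i * a i y₀ ≤ 0 :=
            Finset.sum_nonpos fun i hi => mul_nonpos_of_nonneg_of_nonpos (hp i) (e2 i hi)
          simp only [Function.update_self]
          linarith
        · simp [hi, hp i]
      · have hupd : ∀ c : ℝ, ∑ i ∈ s, Function.update p j c i • a i = ∑ i ∈ s, p i • a i :=
          fun c => Finset.sum_congr rfl fun i hi => by
            rw [Function.update_of_ne (ne_of_mem_of_not_mem hi hj)]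
        rw [Finset.sum_insert hj, Function.update_self, hupd]
        ext y
        have := congrArg (fun f => f y) hg
        simp only [LinearMap.sub_apply, LinearMap.smul_apply, smul_eq_mul, LinearMap.add_apply,
          LinearMap.sum_apply, mul_sub, Finset.sum_sub_distrib] at this ⊢
        rw [sub_mul, Finset.sum_mul]
        simp only [mul_comm, mul_left_comm] at this ⊢
        linarith

/-- Affine form of **Farkas' lemma**: a linear inequality implied by a feasible finite system of
linear inequalities is a nonnegative combination of them, up to weakening its right-hand side. -/
theorem exists_multipliers_of_forall_le {V ι : Type*} [AddCommGroup V] [Module ℝ V] [Fintype ι]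
    (a : ι → V →ₗ[ℝ] ℝ) (b : ι → ℝ) (g : V →ₗ[ℝ] ℝ) (β : ℝ) (y₀ : V) (hy₀ : ∀ i, a i y₀ ≤ b i)
    (h : ∀ y, (∀ i, a i y ≤ b i) → g y ≤ β) :
    ∃ p : ι → ℝ, (∀ i, 0 ≤ p i) ∧ g = ∑ i, p i • a i ∧ ∑ i, p i * b i ≤ β := by
  -- Homogenize in `V × ℝ`: the constraints become `a i y ≤ τ * b i` and `0 ≤ τ`.
  let a' : Option ι → V × ℝ →ₗ[ℝ] ℝ := fun o => match o with
    | none => -LinearMap.snd ℝ V ℝ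
    | some i => a i ∘ₗ LinearMap.fst ℝ V ℝ - b i • LinearMap.snd ℝ V ℝ
  obtain ⟨p, hp, hg⟩ := farkas_finset Finset.univ a'
    (g ∘ₗ LinearMap.fst ℝ V ℝ - β • LinearMap.snd ℝ V ℝ) (by
      rintro ⟨y, τ⟩ hy
      have h0 := hy none (Finset.mem_univ _)
      have h1 : ∀ i, a i y ≤ b i * τ := fun i => by
        have := hy (some i) (Finset.mem_univ _)
        simpa [a'] using this
      simp only [a', LinearMap.neg_apply, LinearMap.snd_apply, Left.neg_nonpos_iff] at h0
      simp only [LinearMap.sub_apply, LinearMap.comp_apply, LinearMap.fst_apply,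
        LinearMap.smul_apply, LinearMap.snd_apply, smul_eq_mul]
      rcases h0.eq_or_lt with h0 | h0
      · -- `y` is a recession direction, so `y₀ + K y` is feasible for all `K ≥ 0`.
        subst h0
        by_contra hcon
        have hpos : 0 < g y := by linarith
        set K := (|β - g y₀| + 1) / g y with hK
        have hK0 : 0 ≤ K := by positivity
        have := h (y₀ + K • y) fun i => by
          have h1i := h1 i
          have := mul_nonneg hK0 (show 0 ≤ -a i y by linarith)
          have := hy₀ i
          simp only [map_add, map_smul, smul_eq_mul]
          linarith
        have e : K * g y = |β - g y₀| + 1 := by rw [hK]; field_simp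
        simp only [map_add, map_smul, smul_eq_mul, e] at this
        linarith [le_abs_self (β - g y₀)]
      · have := h (τ⁻¹ • y) fun i => by
          simp only [map_smul, smul_eq_mul]
          rw [inv_mul_le_iff₀ h0, mul_comm]
          exact h1 i
        simp only [map_smul, smul_eq_mul] at this
        rw [inv_mul_le_iff₀ h0] at this
        linarith)
  refine ⟨fun i => p (some i), fun i => hp _, ?_, ?_⟩
  · ext y
    have := congrArg (fun f => f (y, (0 : ℝ))) hg
    simpa [a', Fintype.sum_option] using this
  · have := congrArg (fun f => f ((0 : V), (1 : ℝ))) hg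
    simp [a', Fintype.sum_option] at this
    have := hp none
    linarith

/-- Linear programming duality in matrix form. -/
theorem exists_dual_of_forall_le {m n : ℕ} (A : Matrix (Fin m) (Fin n) ℝ) (b : Fin m → ℝ)
    (g : Fin n → ℝ) (β : ℝ) (hne : ∃ y, A *ᵥ y ≤ b) (h : ∀ y, A *ᵥ y ≤ b → g ⬝ᵥ y ≤ β) :
    ∃ p : Fin m → ℝ, 0 ≤ p ∧ Aᵀ *ᵥ p = g ∧ b ⬝ᵥ p ≤ β := by
  obtain ⟨y₀, hy₀⟩ := hne
  obtain ⟨p, hp, hg, hb⟩ := exists_multipliers_of_forall_le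
    (fun i => dotProductBilin ℝ ℝ (A i)) b (dotProductBilin ℝ ℝ g) β y₀ (fun i => hy₀ i)
    (fun y hy => h y fun i => hy i)
  refine ⟨p, hp, ?_, ?_⟩
  · ext j
    have := congrArg (fun f => f (Pi.single j 1)) hg
    simp [dotProductBilin] at this
    simp [mulVec, dotProduct, this, mul_comm]
  · simpa [dotProduct, mul_comm] using hb

/-- Linear programming duality with one distinguished constraint `c ⬝ᵥ y ≤ φ`. -/
theorem exists_dual_of_forall_le' {m n : ℕ} (A : Matrix (Fin m) (Fin n) ℝ) (b : Fin m → ℝ)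
    (c g : Fin n → ℝ) (φ β : ℝ) (hne : ∃ y, A *ᵥ y ≤ b ∧ c ⬝ᵥ y ≤ φ)
    (h : ∀ y, A *ᵥ y ≤ b → c ⬝ᵥ y ≤ φ → g ⬝ᵥ y ≤ β) :
    ∃ (p : Fin m → ℝ) (lam : ℝ), 0 ≤ p ∧ 0 ≤ lam ∧ Aᵀ *ᵥ p + lam • c = g ∧
      b ⬝ᵥ p + lam * φ ≤ β := by
  obtain ⟨y₀, hy₀, hc₀⟩ := hne
  obtain ⟨p, hp, hg, hb⟩ := exists_multipliers_of_forall_le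
    (fun o : Option (Fin m) => dotProductBilin ℝ ℝ (o.elim c A)) (fun o => o.elim φ b)
    (dotProductBilin ℝ ℝ g) β y₀
    (by rintro (_ | i); exacts [hc₀, hy₀ i])
    (fun y hy => h y (fun i => hy (some i)) (hy none))
  refine ⟨fun i => p (some i), p none, fun i => hp _, hp _, ?_, ?_⟩
  · ext j
    have := congrArg (fun f => f (Pi.single j 1)) hg
    simp [dotProductBilin, Fintype.sum_option] at this
    simp [mulVec, dotProduct, this, mul_comm, add_comm, Option.elim]
  · simpa [dotProduct, mul_comm, Fintype.sum_option, add_comm] using hb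

/-- A finite system `a s ≤ d s ⬝ᵥ u` is solvable as soon as no nonnegative combination of it reads
`0 < 0`. This describes the solvable right-hand sides by closed conditions. -/
theorem exists_le_dotProduct {k N : ℕ} (D : Fin N → Fin k → ℝ) (a : Fin N → ℝ)
    (h : ∀ p : Fin N → ℝ, 0 ≤ p → ∑ s, p s • D s = 0 → ∑ s, p s * a s ≤ 0) :
    ∃ u : Fin k → ℝ, ∀ s, a s ≤ D s ⬝ᵥ u := by
  by_contra hcon
  push Not at hcon
  -- If there is no solution, then `a s * τ ≤ D s ⬝ᵥ u` for all `s` forces `τ ≤ 0`.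
  obtain ⟨p, hp, hg⟩ := farkas_finset Finset.univ
    (fun s => a s • LinearMap.snd ℝ (Fin k → ℝ) ℝ
      - dotProductBilin ℝ ℝ (D s) ∘ₗ LinearMap.fst ℝ (Fin k → ℝ) ℝ)
    (LinearMap.snd ℝ (Fin k → ℝ) ℝ) (by
      rintro ⟨y, τ⟩ hy
      simp only [LinearMap.snd_apply]
      by_contra hτ
      rw [not_le] at hτ
      obtain ⟨s, hs⟩ := hcon (τ⁻¹ • y)
      have := hy s (Finset.mem_univ _)
      simp [dotProductBilin] at this
      rw [dotProduct_smul, smul_eq_mul, inv_mul_lt_iff₀ hτ] at hs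
      linarith)
  have h1 : ∑ s, p s • D s = 0 := by
    ext j
    have := congrArg (fun f => f (Pi.single j 1, (0 : ℝ))) hg
    simp [dotProductBilin] at this
    simpa using this
  have h2 := congrArg (fun f => f ((0 : Fin k → ℝ), (1 : ℝ))) hg
  simp [dotProductBilin] at h2
  linarith [h p hp h1]

/-! ### The follower's problem -/

namespace BilevelData

variable {d k m n N : ℕ} (I : BilevelData d k m n N)

theorem isClosed_followerSet (x : Fin d → ℝ) (z : Fin k → ℝ) : IsClosed (I.followerSet x z) :=
  isClosed_le (by fun_prop) continuous_const

theorem nonempty_Ω {x : Fin d → ℝ} {z : Fin k → ℝ} (hne : (I.followerSet x z).Nonempty)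
    (hbd : Bornology.IsBounded (I.followerSet x z)) : (I.Ω x z).Nonempty := by
  obtain ⟨y, hy, hmin⟩ := (Metric.isCompact_of_isClosed_isBounded
    (I.isClosed_followerSet x z) hbd).exists_isMinOn hne
    (f := fun y => I.cost z ⬝ᵥ y) (by fun_prop)
  exact ⟨y, hy, fun y' hy' => hmin hy'⟩

theorem isCompact_Ω {x : Fin d → ℝ} {z : Fin k → ℝ}
    (hbd : Bornology.IsBounded (I.followerSet x z)) : IsCompact (I.Ω x z) := by
  refine Metric.isCompact_of_isClosed_isBounded ?_ (hbd.subset fun y hy => hy.1)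
  have : I.Ω x z = I.followerSet x z ∩
      ⋂ y' ∈ I.followerSet x z, {y | I.cost z ⬝ᵥ y ≤ I.cost z ⬝ᵥ y'} := by
    ext y; simp [Ω]
  rw [this]
  exact (I.isClosed_followerSet x z).inter
    (isClosed_biInter fun y' _ => isClosed_le (by fun_prop) continuous_const)

theorem isGreatest_Ψ {x : Fin d → ℝ} {z : Fin k → ℝ} (hne : (I.followerSet x z).Nonempty)
    (hbd : Bornology.IsBounded (I.followerSet x z)) :
    IsGreatest ((fun y => I.leaderCost z ⬝ᵥ y) '' I.Ω x z) (I.Ψ x z) :=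
  ((I.isCompact_Ω hbd).image (by fun_prop)).isGreatest_sSup ((I.nonempty_Ω hne hbd).image _)

/-- Weak duality for the lexicographic linear program defining `Ψ`. The variable `y` stands for
`lam` times a feasible point of the follower (a recession direction if `lam = 0`), so that
`I.cost z ⬝ᵥ y` bounds `lam` times the follower's optimal value from above. -/
theorem Ψ_le_of_multipliers {x : Fin d → ℝ} {z : Fin k → ℝ}
    (hne : (I.followerSet x z).Nonempty) (hbd : Bornology.IsBounded (I.followerSet x z))
    {p : Fin m → ℝ} {y : Fin n → ℝ} {lam : ℝ} (hp : 0 ≤ p) (hlam : 0 ≤ lam)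
    (hdual : I.Aᵀ *ᵥ p + lam • I.cost z = I.leaderCost z)
    (hy : I.A *ᵥ y ≤ lam • I.rhs x z) :
    I.Ψ x z ≤ I.rhs x z ⬝ᵥ p + I.cost z ⬝ᵥ y := by
  obtain ⟨⟨y₁, ⟨hy₁, hopt⟩, hΨ⟩, -⟩ := I.isGreatest_Ψ hne hbd
  rw [← hΨ]
  have h1 : I.leaderCost z ⬝ᵥ y₁ = (I.A *ᵥ y₁) ⬝ᵥ p + lam * (I.cost z ⬝ᵥ y₁) := by
    rw [← hdual, add_dotProduct, smul_dotProduct, smul_eq_mul, mulVec_transpose,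
      ← dotProduct_mulVec, dotProduct_comm p]
  have h2 : (I.A *ᵥ y₁) ⬝ᵥ p ≤ I.rhs x z ⬝ᵥ p := dotProduct_le_dotProduct_of_nonneg_right hy₁ hp
  have h3 : lam * (I.cost z ⬝ᵥ y₁) ≤ I.cost z ⬝ᵥ y := by
    rcases hlam.eq_or_lt with rfl | hlam
    · have := hopt (y₁ + y) (by
        change I.A *ᵥ (y₁ + y) ≤ _
        rw [mulVec_add]
        simpa using add_le_add hy₁ hy)
      rw [dotProduct_add] at this
      linarith
    · have := hopt (lam⁻¹ • y) (by
        change I.A *ᵥ (lam⁻¹ • y) ≤ _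
        rw [mulVec_smul, inv_smul_le_iff_of_pos hlam]
        exact hy)
      rw [dotProduct_smul, smul_eq_mul] at this
      calc lam * (I.cost z ⬝ᵥ y₁) ≤ lam * (lam⁻¹ * (I.cost z ⬝ᵥ y)) := by gcongr
        _ = _ := by field_simp
  change I.leaderCost z ⬝ᵥ y₁ ≤ _
  linarith

/-- Strong duality for the lexicographic linear program defining `Ψ`: every sufficiently large
multiplier `lam` of the follower's optimality constraint is part of an optimal dual solution. Hence
one `lam` can serve all scenarios. -/
theorem exists_multipliers {x : Fin d → ℝ} {z : Fin k → ℝ}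
    (hne : (I.followerSet x z).Nonempty) (hbd : Bornology.IsBounded (I.followerSet x z)) :
    ∃ L : ℝ, 0 ≤ L ∧ ∀ lam, L ≤ lam → ∃ (p : Fin m → ℝ) (y : Fin n → ℝ), 0 ≤ p ∧
      I.Aᵀ *ᵥ p + lam • I.cost z = I.leaderCost z ∧ I.A *ᵥ y ≤ lam • I.rhs x z ∧
      I.rhs x z ⬝ᵥ p + I.cost z ⬝ᵥ y ≤ I.Ψ x z := by
  obtain ⟨y₁, hy₁, hopt⟩ := I.nonempty_Ω hne hbd
  obtain ⟨p, L, hp, hL, hpL, hval⟩ := exists_dual_of_forall_le' I.A (I.rhs x z) (I.cost z)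
    (I.leaderCost z) (I.cost z ⬝ᵥ y₁) (I.Ψ x z) ⟨y₁, hy₁, le_rfl⟩
    (fun y hy hc => (I.isGreatest_Ψ hne hbd).2
      ⟨y, ⟨hy, fun y' hy' => hc.trans (hopt y' hy')⟩, rfl⟩)
  -- An optimal dual solution `u` of the follower absorbs any increase of `lam` at no cost.
  obtain ⟨u, hu, hAu, hbu⟩ := exists_dual_of_forall_le I.A (I.rhs x z) (-I.cost z)
    (-(I.cost z ⬝ᵥ y₁)) ⟨y₁, hy₁⟩ (fun y hy => by
      rw [neg_dotProduct]; exact neg_le_neg (hopt y hy))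
  refine ⟨L, hL, fun lam hlam => ⟨p + (lam - L) • u, lam • y₁, ?_, ?_, ?_, ?_⟩⟩
  · exact add_nonneg hp (smul_nonneg (sub_nonneg.2 hlam) hu)
  · rw [mulVec_add, mulVec_smul, hAu, ← hpL]
    module
  · rw [mulVec_smul]
    exact smul_le_smul_of_nonneg_left hy₁ (hL.trans hlam)
  · rw [dotProduct_add, dotProduct_smul, dotProduct_smul, smul_eq_mul, smul_eq_mul]
    have := mul_le_mul_of_nonneg_left hbu (sub_nonneg.2 hlam)
    linarith

theorem rhs_eq (x : Fin d → ℝ) (z : Fin k → ℝ) :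
    I.rhs x z = ∑ i, x i • (I.B i *ᵥ z + I.b i) + (I.B0 *ᵥ z + I.b0) := by
  simp only [rhs, add_mulVec, sum_mulVec, smul_mulVec, smul_add, Finset.sum_add_distrib]
  abel

/-! ### Eliminating the linearized variables -/

/-- The lower bound that the semidefinite program imposes on `t`. -/
def momentTerm (Q : Matrix (Fin k) (Fin k) ℝ) (q : Fin k → ℝ) : ℝ :=
  trace ((I.γ2 • I.S0 + vecMulVec I.μ0 I.μ0)ᵀ * Q) + I.μ0 ⬝ᵥ q
    + Real.sqrt I.γ1 * ‖WithLp.toLp 2 (CFC.sqrt I.S0 *ᵥ (q + (2 : ℝ) • (Q *ᵥ I.μ0)))‖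

variable {I} in
/-- For binary `x` the big-M constraints force `θ i = x i * lam` and `ω i s = x i • p s`. -/
theorem SDPFeasible.Ψ_le {M : ℝ} {x : Fin d → ℝ} {z : SDPVars d k m n N}
    (hx : ∀ i, x i = 0 ∨ x i = 1) (hrec : I.CompleteRecourse) (h : I.SDPFeasible M x z)
    (s : Fin N) :
    I.Ψ x (I.ξ s) - I.ξ s ⬝ᵥ (z.Q *ᵥ I.ξ s) - I.ξ s ⬝ᵥ z.q ≤ z.r := by
  have hθ : ∀ i, z.θ i = x i * z.lam := fun i => by
    have h1 := h.θ_le_mul i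
    have h2 := h.le_θ i
    have h3 := h.θ_nonneg i
    have h4 := h.θ_le_lam i
    rcases hx i with hi | hi <;> rw [hi] at h1 h2 ⊢ <;> linarith
  have hω : ∀ i, z.ω i s = x i • z.p s := fun i => by
    ext j
    have h1 := h.ω_le i s j
    have h2 := h.le_ω i s j
    have h3 := h.neg_le_ω i s j
    have h4 := h.ω_le_mul i s j
    rw [Pi.smul_apply, smul_eq_mul]
    rcases hx i with hi | hi <;> rw [hi] at h1 h2 h3 h4 ⊢ <;> linarith
  have h1 := I.Ψ_le_of_multipliers (hrec x h.x_mem s).1 (hrec x h.x_mem s).2 (h.p_nonneg s)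
    h.lam_nonneg (h.dual_eq s) (y := z.y s) (by
      have := h.primal_le s
      simp only [hθ] at this
      rw [rhs_eq, smul_add, Finset.smul_sum]
      simpa only [smul_smul, mul_comm] using this)
  have h2 := h.epigraph s
  simp only [hω, dotProduct_smul, smul_eq_mul] at h2
  rw [rhs_eq, add_dotProduct, sum_dotProduct] at h1
  simp only [smul_dotProduct, smul_eq_mul] at h1
  linarith

/-- For fixed `x`, optimal dual solutions of the followers' problems complete any moment multipliers
to a feasible point of the semidefinite program. The threshold for `M` bounds the components of
these dual solutions, which do not depend on the moment multipliers. -/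
theorem exists_sdpFeasible {x : Fin d → ℝ} (hxX : x ∈ I.X)
    (hx : ∀ i, x i = 0 ∨ x i = 1) (hrec : I.CompleteRecourse) :
    ∃ M₀ : ℝ, ∀ M, M₀ ≤ M → ∀ (Q : Matrix (Fin k) (Fin k) ℝ) (q : Fin k → ℝ) (r : ℝ),
      Q.PosSemidef → (∀ s, I.Ψ x (I.ξ s) - I.ξ s ⬝ᵥ (Q *ᵥ I.ξ s) - I.ξ s ⬝ᵥ q ≤ r) →
      ∃ z : SDPVars d k m n N, I.SDPFeasible M x z ∧ z.r = r ∧ z.t = I.momentTerm Q q := by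
  choose L hL hmult using fun s => I.exists_multipliers (hrec x hxX s).1 (hrec x hxX s).2
  set lam := ∑ s, L s with hlam
  have hlam0 : 0 ≤ lam := Finset.sum_nonneg fun s _ => hL s
  choose p y hp hdual hy hval using fun s => hmult s lam
    (Finset.single_le_sum (f := L) (fun s _ => hL s) (Finset.mem_univ s))
  refine ⟨lam + ∑ s, ∑ j, p s j, fun M hM Q q r hQ hr =>
    ⟨⟨Q, q, r, I.momentTerm Q q, lam, p, y, fun i => x i * lam, fun i s => x i • p s⟩, ?_,
      rfl, rfl⟩⟩
  have hpM : ∀ s j, p s j ≤ M := fun s j => by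
    have h1 : p s j ≤ ∑ j, p s j :=
      Finset.single_le_sum (f := p s) (fun j _ => hp s j) (Finset.mem_univ j)
    have h2 : ∑ j, p s j ≤ ∑ s, ∑ j, p s j :=
      Finset.single_le_sum (f := fun s => ∑ j, p s j)
        (fun s _ => Finset.sum_nonneg fun j _ => hp s j) (Finset.mem_univ s)
    linarith
  have hlamM : lam ≤ M := by
    have : 0 ≤ ∑ s, ∑ j, p s j :=
      Finset.sum_nonneg fun s _ => Finset.sum_nonneg fun j _ => hp s j
    linarith
  have hp' : ∀ s j, 0 ≤ p s j := fun s j => hp s j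
  refine
    { x_mem := hxX
      epigraph := fun s => ?_
      dual_eq := hdual
      primal_le := fun s => ?_
      moment := le_rfl
      ω_le := fun i s j => ?_
      le_ω := fun i s j => ?_
      neg_le_ω := fun i s j => ?_
      ω_le_mul := fun i s j => ?_
      θ_le_mul := fun i => ?_
      le_θ := fun i => ?_
      θ_nonneg := fun i => ?_
      θ_le_lam := fun i => ?_
      Q_psd := hQ
      lam_nonneg := hlam0
      p_nonneg := hp }
  · have h1 := hval s
    rw [rhs_eq, add_dotProduct, sum_dotProduct] at h1
    simp only [smul_dotProduct, smul_eq_mul] at h1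
    simp only [dotProduct_smul, smul_eq_mul]
    linarith [hr s]
  · have h1 := hy s
    rw [rhs_eq, smul_add, Finset.smul_sum] at h1
    simpa only [smul_smul, mul_comm] using h1
  all_goals
    simp only [Pi.smul_apply, smul_eq_mul]
    rcases hx i with hi | hi <;> rw [hi]
  all_goals first | linarith | linarith [hpM s j, hp' s j]

end BilevelData

/-! ### Positive semidefinite matrices -/

namespace Matrix

variable {k : ℕ}

theorem trace_vecMulVec_mul (a b : Fin k → ℝ) (Q : Matrix (Fin k) (Fin k) ℝ) :
    trace (vecMulVec a b * Q) = b ⬝ᵥ (Q *ᵥ a) := by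
  rw [trace_mul_comm, mul_vecMulVec, trace_vecMulVec, dotProduct_comm]

theorem PosSemidef.transpose_eq {Q : Matrix (Fin k) (Fin k) ℝ} (hQ : Q.PosSemidef) : Qᵀ = Q := by
  simpa using hQ.1.eq

theorem PosSemidef.dotProduct_mulVec_comm {Q : Matrix (Fin k) (Fin k) ℝ} (hQ : Q.PosSemidef)
    (a b : Fin k → ℝ) : a ⬝ᵥ (Q *ᵥ b) = b ⬝ᵥ (Q *ᵥ a) := by
  rw [dotProduct_mulVec, ← mulVec_transpose, hQ.transpose_eq, dotProduct_comm]

theorem PosSemidef.sqrt_mul_sqrt {P : Matrix (Fin k) (Fin k) ℝ} (hP : P.PosSemidef) :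
    CFC.sqrt P * CFC.sqrt P = P :=
  CFC.sqrt_mul_sqrt_self P hP.nonneg

theorem posSemidef_sqrt (P : Matrix (Fin k) (Fin k) ℝ) : (CFC.sqrt P).PosSemidef :=
  (CFC.sqrt_nonneg P).posSemidef

theorem PosDef.isUnit_det_sqrt {P : Matrix (Fin k) (Fin k) ℝ} (hP : P.PosDef) :
    IsUnit (CFC.sqrt P).det := by
  have h := congrArg det hP.posSemidef.sqrt_mul_sqrt
  rw [det_mul] at h
  exact isUnit_iff_ne_zero.2 fun h0 => hP.det_pos.ne' (by rw [← h, h0, zero_mul])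

theorem PosSemidef.sqrt_mul_mul_sqrt {Q : Matrix (Fin k) (Fin k) ℝ} (hQ : Q.PosSemidef)
    (P : Matrix (Fin k) (Fin k) ℝ) : (CFC.sqrt P * Q * CFC.sqrt P).PosSemidef := by
  have := hQ.mul_mul_conjTranspose_same (CFC.sqrt P)
  rwa [(posSemidef_sqrt P).1.eq] at this

theorem PosSemidef.trace_sqrt_mul_mul_sqrt {P : Matrix (Fin k) (Fin k) ℝ} (hP : P.PosSemidef)
    (Q : Matrix (Fin k) (Fin k) ℝ) : trace (CFC.sqrt P * Q * CFC.sqrt P) = trace (P * Q) := by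
  rw [trace_mul_comm, ← mul_assoc, hP.sqrt_mul_sqrt]

theorem PosSemidef.trace_mul_nonneg {P Q : Matrix (Fin k) (Fin k) ℝ} (hP : P.PosSemidef)
    (hQ : Q.PosSemidef) : 0 ≤ trace (P * Q) := by
  rw [← hP.trace_sqrt_mul_mul_sqrt]
  exact (hQ.sqrt_mul_mul_sqrt P).trace_nonneg

theorem PosSemidef.diag_le_trace {Q : Matrix (Fin k) (Fin k) ℝ} (hQ : Q.PosSemidef) (i : Fin k) :
    Q i i ≤ Q.trace :=
  Finset.single_le_sum (f := fun i => Q i i) (fun _ _ => hQ.diag_nonneg) (Finset.mem_univ i)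

theorem PosSemidef.abs_apply_le_trace {Q : Matrix (Fin k) (Fin k) ℝ} (hQ : Q.PosSemidef)
    (i j : Fin k) : |Q i j| ≤ Q.trace := by
  have hs : Q j i = Q i j := congrFun (congrFun hQ.transpose_eq i) j
  have h1 := hQ.dotProduct_mulVec_nonneg (Pi.single i 1 + Pi.single j 1)
  have h2 := hQ.dotProduct_mulVec_nonneg (Pi.single i 1 - Pi.single j 1)
  simp [mulVec_add, mulVec_sub, hs] at h1 h2
  have h3 := hQ.diag_le_trace i
  have h4 := hQ.diag_le_trace j
  rw [abs_le]
  constructor <;> linarith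

theorem isClosed_setOf_posSemidef : IsClosed {Q : Matrix (Fin k) (Fin k) ℝ | Q.PosSemidef} := by
  have : {Q : Matrix (Fin k) (Fin k) ℝ | Q.PosSemidef} =
      {Q | Qᵀ = Q} ∩ ⋂ x : Fin k → ℝ, {Q | 0 ≤ x ⬝ᵥ (Q *ᵥ x)} := by
    ext Q
    simp [posSemidef_iff_dotProduct_mulVec, IsHermitian]
  rw [this]
  refine (isClosed_eq (by fun_prop) (by fun_prop)).inter
    (isClosed_iInter fun x => isClosed_le (by fun_prop) (by fun_prop))

/-- A positive definite `P` bounds the positive semidefinite matrices `Q` with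
`trace (P * Q) ≤ C`, since `√P * Q * √P` is positive semidefinite with the same trace. -/
theorem PosDef.exists_isCompact_of_trace_le {P : Matrix (Fin k) (Fin k) ℝ} (hP : P.PosDef)
    (C : ℝ) : ∃ K : Set (Matrix (Fin k) (Fin k) ℝ), IsCompact K ∧
      ∀ Q : Matrix (Fin k) (Fin k) ℝ, Q.PosSemidef → trace (P * Q) ≤ C → Q ∈ K := by
  have hK : IsCompact (Set.pi Set.univ fun _ : Fin k => Set.pi Set.univ fun _ : Fin k =>
      Set.Icc (-C) C) :=
    isCompact_univ_pi fun _ => isCompact_univ_pi fun _ => isCompact_Icc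
  refine ⟨_, hK.image (f := fun X : Matrix (Fin k) (Fin k) ℝ =>
    (CFC.sqrt P)⁻¹ * X * (CFC.sqrt P)⁻¹) (by fun_prop), fun Q hQ hC =>
    ⟨CFC.sqrt P * Q * CFC.sqrt P, fun i _ j _ => ?_, ?_⟩⟩
  · rw [Set.mem_Icc, ← abs_le]
    refine ((hQ.sqrt_mul_mul_sqrt P).abs_apply_le_trace i j).trans ?_
    rwa [hP.posSemidef.trace_sqrt_mul_mul_sqrt]
  · have hu := hP.isUnit_det_sqrt
    simp only [mul_assoc, mul_nonsing_inv _ hu, mul_one]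
    rw [← mul_assoc, nonsing_inv_mul _ hu, one_mul]

theorem norm_toLp_sq (a : Fin k → ℝ) : ‖WithLp.toLp 2 a‖ ^ 2 = a ⬝ᵥ a := by
  rw [EuclideanSpace.real_norm_sq_eq]
  simp [dotProduct, sq]

theorem dotProduct_le_norm_mul_norm (a b : Fin k → ℝ) :
    a ⬝ᵥ b ≤ ‖WithLp.toLp 2 a‖ * ‖WithLp.toLp 2 b‖ := by
  have := real_inner_le_norm (WithLp.toLp 2 b) (WithLp.toLp 2 a)
  rw [EuclideanSpace.inner_toLp_toLp] at this
  simpa [mul_comm] using this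

theorem PosDef.dotProduct_inv_mulVec {S : Matrix (Fin k) (Fin k) ℝ} (hS : S.PosDef)
    (w : Fin k → ℝ) : w ⬝ᵥ (S⁻¹ *ᵥ w) = ‖WithLp.toLp 2 ((CFC.sqrt S)⁻¹ *ᵥ w)‖ ^ 2 := by
  rw [norm_toLp_sq]
  conv_lhs => rw [← hS.posSemidef.sqrt_mul_sqrt, mul_inv_rev, ← mulVec_mulVec]
  rw [dotProduct_mulVec, ← mulVec_transpose, (posSemidef_sqrt S).inv.transpose_eq]

/-- The Cauchy–Schwarz inequality for the norm of a positive definite `S` and its dual norm. -/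
theorem PosDef.dotProduct_le_norm_sqrt {S : Matrix (Fin k) (Fin k) ℝ} (hS : S.PosDef)
    (w u : Fin k → ℝ) : w ⬝ᵥ u ≤
      ‖WithLp.toLp 2 ((CFC.sqrt S)⁻¹ *ᵥ w)‖ * ‖WithLp.toLp 2 (CFC.sqrt S *ᵥ u)‖ := by
  refine le_trans (le_of_eq ?_) (dotProduct_le_norm_mul_norm _ _)
  rw [dotProduct_mulVec, ← mulVec_transpose, (posSemidef_sqrt S).transpose_eq, mulVec_mulVec,
    mul_nonsing_inv _ hS.isUnit_det_sqrt, one_mulVec]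

/-- The ellipsoid `wᵀ S⁻¹ w ≤ γ` is described by its support function. -/
theorem PosDef.dotProduct_inv_mulVec_le_iff {S : Matrix (Fin k) (Fin k) ℝ} (hS : S.PosDef)
    {γ : ℝ} (hγ : 0 ≤ γ) (w : Fin k → ℝ) : w ⬝ᵥ (S⁻¹ *ᵥ w) ≤ γ ↔
      ∀ u, w ⬝ᵥ u ≤ Real.sqrt γ * ‖WithLp.toLp 2 (CFC.sqrt S *ᵥ u)‖ := by
  rw [hS.dotProduct_inv_mulVec]
  constructor
  · intro h u
    refine (hS.dotProduct_le_norm_sqrt w u).trans ?_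
    gcongr
    exact Real.le_sqrt_of_sq_le h
  · intro h
    have h1 := h (S⁻¹ *ᵥ w)
    have h2 : CFC.sqrt S *ᵥ (S⁻¹ *ᵥ w) = (CFC.sqrt S)⁻¹ *ᵥ w := by
      conv_lhs => rw [← hS.posSemidef.sqrt_mul_sqrt, mul_inv_rev, mulVec_mulVec, ← mul_assoc,
        hS.posSemidef.sqrt_mul_sqrt, mul_nonsing_inv _ hS.isUnit_det_sqrt, one_mul]
    rw [hS.dotProduct_inv_mulVec, h2] at h1
    rw [← Real.sq_sqrt hγ]
    have h3 := norm_nonneg (WithLp.toLp 2 ((CFC.sqrt S)⁻¹ *ᵥ w))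
    rcases h3.eq_or_lt with h3 | h3
    · rw [← h3, zero_pow two_ne_zero]; positivity
    · gcongr
      exact le_of_mul_le_mul_right (by rwa [← sq]) h3

theorem PosDef.exists_isCompact_of_norm_sqrt_le {S : Matrix (Fin k) (Fin k) ℝ} (hS : S.PosDef)
    (C : ℝ) : ∃ K : Set (Fin k → ℝ), IsCompact K ∧
      ∀ u, ‖WithLp.toLp 2 (CFC.sqrt S *ᵥ u)‖ ≤ C → u ∈ K := by
  refine ⟨_, (isCompact_closedBall (0 : EuclideanSpace ℝ (Fin k)) C).image
    (f := fun a => (CFC.sqrt S)⁻¹ *ᵥ WithLp.ofLp a) (by fun_prop), fun u hu =>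
    ⟨WithLp.toLp 2 (CFC.sqrt S *ᵥ u), by simpa using hu, ?_⟩⟩
  simp [mulVec_mulVec, nonsing_inv_mul _ hS.isUnit_det_sqrt]

theorem norm_toLp_mulVec_combo_le (R : Matrix (Fin k) (Fin k) ℝ) {a b : ℝ} (ha : 0 ≤ a) (hb : 0 ≤ b)
    (u₁ u₂ : Fin k → ℝ) : ‖WithLp.toLp 2 (R *ᵥ (a • u₁ + b • u₂))‖ ≤
      a * ‖WithLp.toLp 2 (R *ᵥ u₁)‖ + b * ‖WithLp.toLp 2 (R *ᵥ u₂)‖ := by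
  rw [mulVec_add, mulVec_smul, mulVec_smul, WithLp.toLp_add, WithLp.toLp_smul, WithLp.toLp_smul]
  refine (norm_add_le _ _).trans (le_of_eq ?_)
  rw [norm_smul, norm_smul, Real.norm_of_nonneg ha, Real.norm_of_nonneg hb]

end Matrix

/-! ### Duality for the moment problem -/

namespace BilevelData

variable {d k m n N : ℕ} (I : BilevelData d k m n N)

/-- The support function of the two moment constraints, in the multiplier `Q` of the second moment
constraint and the multiplier `u` of the mean constraint. -/
def momentSupport (Q : Matrix (Fin k) (Fin k) ℝ) (u : Fin k → ℝ) : ℝ :=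
  I.γ2 * trace (I.S0 * Q) + Real.sqrt I.γ1 * ‖WithLp.toLp 2 (CFC.sqrt I.S0 *ᵥ u)‖

/-- `α` is the value of a feasible solution of the dual of `sup_{p ∈ D} ∑ s, p s * ψ s`. Compared
with the semidefinite program, the scenarios are centred at `μ0` and `u = q + 2 Q μ0`. -/
def IsDualBound (ψ : Fin N → ℝ) (Q : Matrix (Fin k) (Fin k) ℝ) (u : Fin k → ℝ) (α : ℝ) : Prop :=
  Q.PosSemidef ∧ ∀ s, ψ s - (I.ξ s - I.μ0) ⬝ᵥ (Q *ᵥ (I.ξ s - I.μ0)) - (I.ξ s - I.μ0) ⬝ᵥ u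
    + I.momentSupport Q u ≤ α

theorem momentTerm_eq {Q : Matrix (Fin k) (Fin k) ℝ} (hS0 : I.S0.PosDef) (q : Fin k → ℝ) :
    I.momentTerm Q q = I.μ0 ⬝ᵥ (Q *ᵥ I.μ0) + I.μ0 ⬝ᵥ q
      + I.momentSupport Q (q + (2 : ℝ) • (Q *ᵥ I.μ0)) := by
  rw [momentTerm, momentSupport, transpose_add, transpose_smul, hS0.posSemidef.transpose_eq,
    transpose_vecMulVec, add_mul, trace_add, smul_mul, trace_smul, trace_vecMulVec_mul, smul_eq_mul]
  ring

theorem isDualBound_iff {ψ : Fin N → ℝ} {Q : Matrix (Fin k) (Fin k) ℝ} (hS0 : I.S0.PosDef)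
    (q : Fin k → ℝ) (α : ℝ) : I.IsDualBound ψ Q (q + (2 : ℝ) • (Q *ᵥ I.μ0)) α ↔
      Q.PosSemidef ∧ ∀ s, ψ s - I.ξ s ⬝ᵥ (Q *ᵥ I.ξ s) - I.ξ s ⬝ᵥ q ≤ α - I.momentTerm Q q := by
  refine and_congr_right fun hQ => forall_congr' fun s => ?_
  have h := hQ.dotProduct_mulVec_comm (I.ξ s) I.μ0
  rw [I.momentTerm_eq hS0]
  simp only [mulVec_sub, dotProduct_sub, sub_dotProduct, dotProduct_add, dotProduct_smul,
    smul_eq_mul]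
  constructor <;> intro h' <;> linarith

theorem sum_mul_lagrangian (ψ : Fin N → ℝ) (Q : Matrix (Fin k) (Fin k) ℝ) (u : Fin k → ℝ)
    {p : Fin N → ℝ} (hp : ∑ s, p s = 1) :
    ∑ s, p s * (ψ s - (I.ξ s - I.μ0) ⬝ᵥ (Q *ᵥ (I.ξ s - I.μ0)) - (I.ξ s - I.μ0) ⬝ᵥ u
      + I.momentSupport Q u) =
    ∑ s, p s * ψ s + trace ((I.γ2 • I.S0 - I.secondMoment p) * Q)
      + (Real.sqrt I.γ1 * ‖WithLp.toLp 2 (CFC.sqrt I.S0 *ᵥ u)‖ - (I.mean p - I.μ0) ⬝ᵥ u) := by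
  have h1 : trace (I.secondMoment p * Q) =
      ∑ s, p s * ((I.ξ s - I.μ0) ⬝ᵥ (Q *ᵥ (I.ξ s - I.μ0))) := by
    simp only [secondMoment, Finset.sum_mul, trace_sum, smul_mul, trace_smul, trace_vecMulVec_mul,
      smul_eq_mul]
  have h2 : (I.mean p - I.μ0) ⬝ᵥ u = ∑ s, p s * ((I.ξ s - I.μ0) ⬝ᵥ u) := by
    simp only [mean, sub_dotProduct, sum_dotProduct, smul_dotProduct, smul_eq_mul, mul_sub,
      Finset.sum_sub_distrib]
    rw [← Finset.sum_mul, hp, one_mul]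
  simp only [mul_add, mul_sub, Finset.sum_add_distrib, Finset.sum_sub_distrib]
  rw [← Finset.sum_mul, hp, one_mul, sub_mul, trace_sub, smul_mul, trace_smul, h1, h2,
    momentSupport, smul_eq_mul]
  ring

variable {I}

theorem IsDualBound.lagrangian_le {ψ : Fin N → ℝ} {Q : Matrix (Fin k) (Fin k) ℝ} {u : Fin k → ℝ}
    {α : ℝ} (h : I.IsDualBound ψ Q u α) {p : Fin N → ℝ} (hp0 : 0 ≤ p) (hp : ∑ s, p s = 1) :
    ∑ s, p s * ψ s + trace ((I.γ2 • I.S0 - I.secondMoment p) * Q)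
      + (Real.sqrt I.γ1 * ‖WithLp.toLp 2 (CFC.sqrt I.S0 *ᵥ u)‖ - (I.mean p - I.μ0) ⬝ᵥ u) ≤ α := by
  rw [← I.sum_mul_lagrangian ψ Q u hp]
  calc _ ≤ ∑ s, p s * α := Finset.sum_le_sum fun s _ => mul_le_mul_of_nonneg_left (h.2 s) (hp0 s)
    _ = α := by rw [← Finset.sum_mul, hp, one_mul]

/-- Weak duality for the moment problem. -/
theorem IsDualBound.sum_le {ψ : Fin N → ℝ} {Q : Matrix (Fin k) (Fin k) ℝ} {u : Fin k → ℝ}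
    {α : ℝ} (h : I.IsDualBound ψ Q u α) (hS0 : I.S0.PosDef) (hγ1 : 0 ≤ I.γ1) {p : Fin N → ℝ}
    (hp : p ∈ I.ambiguitySet) : ∑ s, p s * ψ s ≤ α := by
  obtain ⟨hp0, hp1, hmean, hcov⟩ := hp
  have h1 := h.lagrangian_le hp0 hp1
  have h2 := hcov.trace_mul_nonneg h.1
  have h3 := (hS0.dotProduct_inv_mulVec_le_iff hγ1 _).1 hmean u
  linarith

/-- Distributions at which the Lagrangian is bounded below belong to the ambiguity set: scaling
the multipliers shows that both moment constraints hold. -/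
theorem mem_ambiguitySet_of_le_lagrangian (hS0 : I.S0.PosDef) (hγ1 : 0 ≤ I.γ1) {p : Fin N → ℝ}
    (hp0 : 0 ≤ p) (hp : ∑ s, p s = 1) {c : ℝ}
    (h : ∀ (Q : Matrix (Fin k) (Fin k) ℝ) (u : Fin k → ℝ), Q.PosSemidef →
      c ≤ trace ((I.γ2 • I.S0 - I.secondMoment p) * Q)
      + (Real.sqrt I.γ1 * ‖WithLp.toLp 2 (CFC.sqrt I.S0 *ᵥ u)‖ - (I.mean p - I.μ0) ⬝ᵥ u)) :
    p ∈ I.ambiguitySet := by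
  -- A linear function on a ray that is bounded below is nonnegative.
  have hray : ∀ a : ℝ, (∀ K : ℝ, 0 ≤ K → c ≤ K * a) → 0 ≤ a := by
    intro a ha
    by_contra hneg
    rw [not_le] at hneg
    have h1 := ha ((|c| + 1) / -a) (div_nonneg (by positivity) (by linarith))
    have h2 : (|c| + 1) / -a * a = -(|c| + 1) := by
      rw [div_mul_eq_mul_div, div_neg, mul_div_assoc, div_self hneg.ne, mul_one]
    rw [h2] at h1
    linarith [neg_abs_le c]
  refine ⟨hp0, hp, (hS0.dotProduct_inv_mulVec_le_iff hγ1 _).2 fun u => ?_, ?_⟩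
  · refine sub_nonneg.1 (hray _ fun K hK => ?_)
    refine (h 0 (K • u) PosSemidef.zero).trans (le_of_eq ?_)
    rw [mul_zero, trace_zero, mulVec_smul, WithLp.toLp_smul, norm_smul, Real.norm_of_nonneg hK,
      dotProduct_smul, smul_eq_mul]
    ring
  · refine PosSemidef.of_dotProduct_mulVec_nonneg ?_ fun a => hray _ fun K hK => ?_
    · have h1 : (I.secondMoment p)ᴴ = I.secondMoment p := by
        simp [secondMoment, transpose_sum, transpose_vecMulVec]
      rw [IsHermitian, conjTranspose_sub, h1, conjTranspose_smul, hS0.1.eq]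
      simp
    · have h1 : (vecMulVec a a).PosSemidef := by
        simpa using posSemidef_vecMulVec_self_star a
      refine (h (K • vecMulVec a a) 0 (h1.smul hK)).trans (le_of_eq ?_)
      rw [Matrix.mul_smul, trace_smul, trace_mul_comm, trace_vecMulVec_mul]
      simp

/-- A convex set that misses an open orthant `{a | ∀ s, a s < α}` is separated from it by a
probability vector. -/
theorem exists_probability_separating {W : Set (Fin N → ℝ)} (hWconv : Convex ℝ W)
    (hWne : W.Nonempty) {α : ℝ} (hdisj : ∀ a ∈ W, ∃ s, α ≤ a s) :
    ∃ p : Fin N → ℝ, 0 ≤ p ∧ ∑ s, p s = 1 ∧ ∀ a ∈ W, α ≤ ∑ s, p s * a s := by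
  obtain ⟨f, c, hfU, hfW⟩ := geometric_hahn_banach_open
    (s := Set.pi Set.univ fun _ : Fin N => Set.Iio α) (t := W)
    (convex_pi fun _ _ => convex_Iio α)
    (isOpen_set_pi Set.finite_univ fun _ _ => isOpen_Iio) hWconv (by
      rw [Set.disjoint_left]
      intro a ha haW
      obtain ⟨s, hs⟩ := hdisj a haW
      exact absurd (ha s (Set.mem_univ s)) (not_lt.2 hs))
  set π : Fin N → ℝ := fun s => f (Pi.single s 1) with hπ
  have hf : ∀ a, f a = ∑ s, π s * a s := fun a => by
    conv_lhs => rw [pi_eq_sum_univ' a, map_sum]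
    simp [hπ, mul_comm]
  obtain ⟨a₀, ha₀⟩ := hWne
  have hπ0 : ∀ s, 0 ≤ π s := by
    intro s
    by_contra hneg
    rw [not_le] at hneg
    -- Going down along the `s`-th axis stays in the orthant, but increases `f` without bound.
    have h1 := hfU ((fun _ => α - 1) - (|c - f fun _ => α - 1| / -π s) • Pi.single s 1)
      (fun i _ => by
        have h0 : 0 ≤ (|c - f fun _ => α - 1| / -π s) * (Pi.single s 1 : Fin N → ℝ) i :=
          mul_nonneg (div_nonneg (abs_nonneg _) (by linarith))
            ((Pi.single_nonneg.2 zero_le_one : (0 : Fin N → ℝ) ≤ Pi.single s 1) i)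
        simp only [Pi.sub_apply, Pi.smul_apply, smul_eq_mul, Set.mem_Iio]
        linarith)
    have h2 : |c - f fun _ => α - 1| / -π s * f (Pi.single s 1) = -|c - f fun _ => α - 1| := by
      change _ / -π s * π s = _
      rw [div_mul_eq_mul_div, div_neg, mul_div_assoc, div_self hneg.ne, mul_one]
    rw [map_sub, map_smul, smul_eq_mul, h2] at h1
    linarith [le_abs_self (c - f fun _ => α - 1)]
  have hsum : 0 < ∑ s, π s := by
    refine (Finset.sum_nonneg fun s _ => hπ0 s).lt_of_ne fun h0 => ?_
    have hz := (Finset.sum_eq_zero_iff_of_nonneg fun s _ => hπ0 s).1 h0.symm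
    have hf0 : ∀ a, f a = 0 := fun a => by
      rw [hf]; exact Finset.sum_eq_zero fun s hs => by rw [hz s hs, zero_mul]
    have h1 := hfU (fun _ => α - 1) (fun s _ => by simp)
    have h2 := hfW a₀ ha₀
    rw [hf0] at h1 h2
    linarith
  have hc : (∑ s, π s) * α ≤ c := by
    refine le_of_forall_pos_lt_add fun ε hε => ?_
    have h1 := hfU (fun _ => α - ε / ∑ s, π s) fun s _ => by
      have : 0 < ε / ∑ s, π s := by positivity
      simp only [Set.mem_Iio]
      linarith
    rw [hf, ← Finset.sum_mul, mul_sub, mul_div_cancel₀ _ hsum.ne'] at h1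
    linarith
  refine ⟨fun s => π s / ∑ s, π s, fun s => div_nonneg (hπ0 s) hsum.le, ?_, fun a ha => ?_⟩
  · rw [← Finset.sum_div, div_self hsum.ne']
  · have h1 := hfW a ha
    rw [hf] at h1
    simp only [div_mul_eq_mul_div]
    rw [← Finset.sum_div, le_div_iff₀ hsum]
    linarith

/-- Strong duality for the moment problem, without any constraint qualification: the set `W` of
vectors dominating a dual slack vector is convex, and if it missed the open orthant below `α`, a
separating functional would be a distribution in the ambiguity set of value at least `α`. -/
theorem exists_isDualBound_of_forall_lt (hS0 : I.S0.PosDef) (hγ1 : 0 ≤ I.γ1) {ψ : Fin N → ℝ}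
    {α : ℝ} (h : ∀ p ∈ I.ambiguitySet, ∑ s, p s * ψ s < α) :
    ∃ Q u, I.IsDualBound ψ Q u α := by
  by_contra! hcon
  set W : Set (Fin N → ℝ) := {a | ∃ Q u, Q.PosSemidef ∧ ∀ s, ψ s
    - (I.ξ s - I.μ0) ⬝ᵥ (Q *ᵥ (I.ξ s - I.μ0)) - (I.ξ s - I.μ0) ⬝ᵥ u + I.momentSupport Q u ≤ a s}
  have hWconv : Convex ℝ W := by
    rintro a₁ ⟨Q₁, u₁, hQ₁, h₁⟩ a₂ ⟨Q₂, u₂, hQ₂, h₂⟩ t₁ t₂ ht₁ ht₂ ht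
    refine ⟨t₁ • Q₁ + t₂ • Q₂, t₁ • u₁ + t₂ • u₂, (hQ₁.smul ht₁).add (hQ₂.smul ht₂), fun s => ?_⟩
    have e₁ := mul_le_mul_of_nonneg_left (h₁ s) ht₁
    have e₂ := mul_le_mul_of_nonneg_left (h₂ s) ht₂
    have e₃ := mul_le_mul_of_nonneg_left (norm_toLp_mulVec_combo_le (CFC.sqrt I.S0) ht₁ ht₂ u₁ u₂)
      (Real.sqrt_nonneg I.γ1)
    have e₄ : ψ s = t₁ * ψ s + t₂ * ψ s := by rw [← add_mul, ht, one_mul]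
    simp only [momentSupport, add_mulVec, smul_mulVec, dotProduct_add, dotProduct_smul, mul_add,
      Matrix.mul_smul, trace_add, trace_smul, smul_eq_mul, Pi.add_apply, Pi.smul_apply] at e₁ e₂ e₃ ⊢
    linarith
  obtain ⟨p, hp0, hp1, hp⟩ := exists_probability_separating hWconv
    ⟨ψ, 0, 0, PosSemidef.zero, fun s => by simp [momentSupport]⟩ (α := α) (by
      rintro a ⟨Q, u, hQ, hs⟩
      by_contra! hlt
      exact hcon Q u ⟨hQ, fun s => (hs s).trans (hlt s).le⟩)
  have hL : ∀ (Q : Matrix (Fin k) (Fin k) ℝ) (u : Fin k → ℝ), Q.PosSemidef →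
      α - ∑ s, p s * ψ s ≤ trace ((I.γ2 • I.S0 - I.secondMoment p) * Q)
      + (Real.sqrt I.γ1 * ‖WithLp.toLp 2 (CFC.sqrt I.S0 *ᵥ u)‖ - (I.mean p - I.μ0) ⬝ᵥ u) := by
    intro Q u hQ
    have h1 := hp _ ⟨Q, u, hQ, fun s => le_rfl⟩
    rw [I.sum_mul_lagrangian ψ Q u hp1] at h1
    linarith
  have h1 := h p (mem_ambiguitySet_of_le_lagrangian hS0 hγ1 hp0 hp1 hL)
  have h2 := hL 0 0 PosSemidef.zero
  simp only [mul_zero, trace_zero, mulVec_zero, WithLp.toLp_zero, norm_zero, dotProduct_zero] at h2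
  linarith

end BilevelData

/-! ### Attainment in the dual of the moment problem -/

namespace BilevelData

variable {d k m n N : ℕ} {I : BilevelData d k m n N}

theorem exists_isDualBound_zero (ψ : Fin N → ℝ) : ∃ α, I.IsDualBound ψ 0 0 α := by
  refine ⟨∑ s, |ψ s|, PosSemidef.zero, fun s => ?_⟩
  have h1 : |ψ s| ≤ ∑ s, |ψ s| :=
    Finset.single_le_sum (f := fun s => |ψ s|) (fun s _ => abs_nonneg _) (Finset.mem_univ s)
  simpa [momentSupport] using (le_abs_self _).trans h1

/-- If the mean constraint holds strictly at some `p`, then both multipliers are bounded on the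
sublevel sets of the dual. -/
theorem exists_least_isDualBound_of_mean_lt (hS0 : I.S0.PosDef) {p : Fin N → ℝ}
    (hp0 : 0 ≤ p) (hp1 : ∑ s, p s = 1)
    (hmean : (I.mean p - I.μ0) ⬝ᵥ (I.S0⁻¹ *ᵥ (I.mean p - I.μ0)) < I.γ1)
    (hcov : (I.γ2 • I.S0 - I.secondMoment p).PosDef) (ψ : Fin N → ℝ) :
    ∃ Q u α, I.IsDualBound ψ Q u α ∧ ∀ Q' u' β, I.IsDualBound ψ Q' u' β → α ≤ β := by
  obtain ⟨α₀, hα₀⟩ := I.exists_isDualBound_zero ψ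
  set δ := Real.sqrt I.γ1 - ‖WithLp.toLp 2 ((CFC.sqrt I.S0)⁻¹ *ᵥ (I.mean p - I.μ0))‖ with hδdef
  have hδ : 0 < δ := by
    rw [hS0.dotProduct_inv_mulVec] at hmean
    exact sub_pos.2 (Real.lt_sqrt_of_sq_lt hmean)
  set C := α₀ - ∑ s, p s * ψ s with hC
  obtain ⟨K₁, hK₁, hmem₁⟩ := hcov.exists_isCompact_of_trace_le C
  obtain ⟨K₂, hK₂, hmem₂⟩ := hS0.exists_isCompact_of_norm_sqrt_le (C / δ)
  set T : Set (Matrix (Fin k) (Fin k) ℝ × (Fin k → ℝ) × ℝ) :=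
    {t | I.IsDualBound ψ t.1 t.2.1 t.2.2 ∧ t.2.2 ≤ α₀} with hT
  have hsub : T ⊆ K₁ ×ˢ K₂ ×ˢ Set.Icc (∑ s, p s * ψ s) α₀ := by
    rintro ⟨Q, u, α⟩ ⟨hb, hα⟩
    have h1 := hb.lagrangian_le hp0 hp1
    have h2 := hcov.posSemidef.trace_mul_nonneg hb.1
    have h3 := hS0.dotProduct_le_norm_sqrt (I.mean p - I.μ0) u
    have h4 : 0 ≤ δ * ‖WithLp.toLp 2 (CFC.sqrt I.S0 *ᵥ u)‖ := by positivity
    have h5 : δ * ‖WithLp.toLp 2 (CFC.sqrt I.S0 *ᵥ u)‖ ≤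
        Real.sqrt I.γ1 * ‖WithLp.toLp 2 (CFC.sqrt I.S0 *ᵥ u)‖ - (I.mean p - I.μ0) ⬝ᵥ u := by
      rw [hδdef, sub_mul]; linarith
    simp only at hα h1
    refine ⟨hmem₁ Q hb.1 (by linarith), hmem₂ u ?_, ?_, hα⟩
    · rw [le_div_iff₀ hδ]; linarith
    · change _ ≤ α; linarith
  have hclosed : IsClosed T := by
    have : T = (Prod.fst ⁻¹' {Q | Q.PosSemidef} ∩ ⋂ s, {t | ψ s
        - (I.ξ s - I.μ0) ⬝ᵥ (t.1 *ᵥ (I.ξ s - I.μ0)) - (I.ξ s - I.μ0) ⬝ᵥ t.2.1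
        + I.momentSupport t.1 t.2.1 ≤ t.2.2}) ∩ {t | t.2.2 ≤ α₀} := by
      ext t; simp [hT, IsDualBound]
    rw [this]
    refine ((isClosed_setOf_posSemidef.preimage continuous_fst).inter
      (isClosed_iInter fun s => isClosed_le ?_ (by fun_prop))).inter
      (isClosed_le (by fun_prop) (by fun_prop))
    unfold momentSupport
    fun_prop
  obtain ⟨⟨Q, u, α⟩, hmem, hmin⟩ := ((hK₁.prod (hK₂.prod isCompact_Icc)).of_isClosed_subset
    hclosed hsub).exists_isMinOn ⟨(0, 0, α₀), hα₀, le_rfl⟩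
    (f := fun t => t.2.2) (by fun_prop)
  refine ⟨Q, u, α, hmem.1, fun Q' u' β hβ => ?_⟩
  rcases le_total β α₀ with h | h
  · exact hmin (a := (Q', u', β)) ⟨hβ, h⟩
  · exact hmem.2.trans h

/-- If `γ1 = 0`, the multiplier `u` of the mean constraint need not be bounded on the sublevel sets
of the dual. It enters linearly and is eliminated with Farkas' lemma; the remaining variables `Q`
and `α` are bounded. -/
theorem exists_least_isDualBound_of_mean_eq (hγ1 : I.γ1 = 0) {p : Fin N → ℝ}
    (hp0 : 0 ≤ p) (hp1 : ∑ s, p s = 1) (hmean : I.mean p = I.μ0)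
    (hcov : (I.γ2 • I.S0 - I.secondMoment p).PosDef) (ψ : Fin N → ℝ) :
    ∃ Q u α, I.IsDualBound ψ Q u α ∧ ∀ Q' u' β, I.IsDualBound ψ Q' u' β → α ≤ β := by
  obtain ⟨α₀, hα₀⟩ := I.exists_isDualBound_zero ψ
  -- The lower bound that the constraint of scenario `s` imposes on `(I.ξ s - I.μ0) ⬝ᵥ u`.
  set D : Fin N → Matrix (Fin k) (Fin k) ℝ × ℝ → ℝ := fun s t =>
    ψ s - (I.ξ s - I.μ0) ⬝ᵥ (t.1 *ᵥ (I.ξ s - I.μ0)) + I.γ2 * trace (I.S0 * t.1) - t.2 with hD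
  have hbound : ∀ Q u α, I.IsDualBound ψ Q u α ↔
      Q.PosSemidef ∧ ∀ s, D s (Q, α) ≤ (I.ξ s - I.μ0) ⬝ᵥ u := by
    intro Q u α
    refine and_congr_right fun _ => forall_congr' fun s => ?_
    simp only [hD, momentSupport, hγ1, Real.sqrt_zero, zero_mul, add_zero]
    constructor <;> intro h <;> linarith
  set P : Set (Fin N → ℝ) := {π | 0 ≤ π ∧ ∑ s, π s • (I.ξ s - I.μ0) = 0} with hP
  set T : Set (Matrix (Fin k) (Fin k) ℝ × ℝ) :=
    (Prod.fst ⁻¹' {Q | Q.PosSemidef} ∩ ⋂ π ∈ P, {t | ∑ s, π s * D s t ≤ 0}) ∩ {t | t.2 ≤ α₀}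
    with hT
  have hTmem : ∀ Q u α, I.IsDualBound ψ Q u α → α ≤ α₀ → (Q, α) ∈ T := by
    intro Q u α hb hα
    rw [hbound] at hb
    refine ⟨⟨hb.1, Set.mem_iInter₂.2 fun π hπ => ?_⟩, hα⟩
    calc ∑ s, π s * D s (Q, α) ≤ ∑ s, π s * ((I.ξ s - I.μ0) ⬝ᵥ u) :=
          Finset.sum_le_sum fun s _ => mul_le_mul_of_nonneg_left (hb.2 s) (hπ.1 s)
      _ = (∑ s, π s • (I.ξ s - I.μ0)) ⬝ᵥ u := by simp [sum_dotProduct]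
      _ = 0 := by rw [hπ.2, zero_dotProduct]
  have hTbound : ∀ t ∈ T, ∃ u, I.IsDualBound ψ t.1 u t.2 := by
    rintro ⟨Q, α⟩ ⟨⟨hQ, hπ⟩, -⟩
    obtain ⟨u, hu⟩ := exists_le_dotProduct (fun s => I.ξ s - I.μ0) (fun s => D s (Q, α))
      fun π h0 h1 => Set.mem_iInter₂.1 hπ π ⟨h0, h1⟩
    exact ⟨u, (hbound Q u α).2 ⟨hQ, hu⟩⟩
  obtain ⟨K, hK, hmemK⟩ := hcov.exists_isCompact_of_trace_le (α₀ - ∑ s, p s * ψ s)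
  have hsub : T ⊆ K ×ˢ Set.Icc (∑ s, p s * ψ s) α₀ := by
    rintro ⟨Q, α⟩ ht
    obtain ⟨u, hb⟩ := hTbound _ ht
    have hα : α ≤ α₀ := ht.2
    have h1 := hb.lagrangian_le hp0 hp1
    have h2 := hcov.posSemidef.trace_mul_nonneg hb.1
    simp only [hγ1, Real.sqrt_zero, zero_mul, hmean, sub_self, zero_dotProduct, add_zero] at h1 h2
    refine ⟨hmemK Q hb.1 (by linarith), ?_, hα⟩
    change _ ≤ α
    linarith
  have hclosed : IsClosed T := by
    refine ((isClosed_setOf_posSemidef.preimage continuous_fst).inter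
      (isClosed_biInter fun π _ => isClosed_le ?_ (by fun_prop))).inter
      (isClosed_le (by fun_prop) (by fun_prop))
    simp only [hD]
    fun_prop
  obtain ⟨⟨Q, α⟩, hmem, hmin⟩ := ((hK.prod isCompact_Icc).of_isClosed_subset
    hclosed hsub).exists_isMinOn ⟨(0, α₀), hTmem 0 0 α₀ hα₀ le_rfl⟩
    (f := fun t => t.2) (by fun_prop)
  obtain ⟨u, hu⟩ := hTbound _ hmem
  refine ⟨Q, u, α, hu, fun Q' u' β hβ => ?_⟩
  rcases le_total β α₀ with h | h
  · exact hmin (hTmem Q' u' β hβ h)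
  · exact hmem.2.trans h

/-- Slater's condition implies that the dual of the moment problem has an optimal solution. -/
theorem StrictlyFeasible.exists_least_isDualBound (h : I.StrictlyFeasible) (hS0 : I.S0.PosDef)
    (hγ1 : 0 ≤ I.γ1) (ψ : Fin N → ℝ) :
    ∃ Q u α, I.IsDualBound ψ Q u α ∧ ∀ Q' u' β, I.IsDualBound ψ Q' u' β → α ≤ β := by
  obtain ⟨p, hp0, hp1, hmean | hmean, hcov⟩ := h
  · exact exists_least_isDualBound_of_mean_lt hS0 hp0 hp1 hmean hcov ψ
  · rcases hγ1.eq_or_lt with h0 | hpos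
    · exact exists_least_isDualBound_of_mean_eq h0.symm hp0 hp1 hmean hcov ψ
    · exact exists_least_isDualBound_of_mean_lt hS0 hp0 hp1
        (by rwa [hmean, sub_self, zero_dotProduct]) hcov ψ

/-- At the sample mean and covariance, the uniform distribution has mean `μ0` and second moment
`((N - 1) / N) • S0`. -/
theorem IsEmpirical.strictlyFeasible (h : I.IsEmpirical) (hS0 : I.S0.PosDef) (hγ2 : 1 ≤ I.γ2) :
    I.StrictlyFeasible := by
  obtain ⟨hN, hμ, hS⟩ := h
  have hN' : (2 : ℝ) ≤ N := by exact_mod_cast hN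
  have hN0 : (N : ℝ) ≠ 0 := by linarith
  have hN1 : (N : ℝ) - 1 ≠ 0 := by linarith
  refine ⟨fun _ => 1 / N, fun _ => by positivity, by simp [hN0], Or.inr ?_, ?_⟩
  · rw [mean, ← Finset.smul_sum, ← hμ]
  · have h1 : I.secondMoment (fun _ => 1 / (N : ℝ)) = (((N : ℝ) - 1) / N) • I.S0 := by
      rw [secondMoment, ← Finset.smul_sum, hS, smul_smul]
      congr 1
      field_simp
    have h2 : ((N : ℝ) - 1) / N < 1 := by
      rw [div_lt_one (by linarith)]; linarith
    rw [h1, ← sub_smul]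
    exact hS0.smul (by linarith)

/-! ### Equivalence of the two programs -/

/-- The semidefinite program with `x` fixed is the dual of the moment problem with `ψ = Ψ x`. -/
theorem SDPFeasible.isDualBound {M : ℝ} {x : Fin d → ℝ} {z : SDPVars d k m n N}
    (hx : ∀ i, x i = 0 ∨ x i = 1) (hrec : I.CompleteRecourse) (hS0 : I.S0.PosDef)
    (h : I.SDPFeasible M x z) :
    I.IsDualBound (fun s => I.Ψ x (I.ξ s)) z.Q (z.q + (2 : ℝ) • (z.Q *ᵥ I.μ0)) (z.r + z.t) := by
  refine (I.isDualBound_iff hS0 z.q _).2 ⟨h.Q_psd, fun s => ?_⟩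
  have h1 := h.Ψ_le hx hrec s
  have h2 : I.momentTerm z.Q z.q ≤ z.t := h.moment
  linarith

/-- Since `X` is finite, one big-M constant allows every solution of the dual of the moment problem
with `ψ = Ψ x` to be completed to a feasible point, for all `x ∈ X`. -/
theorem exists_bigM (hX : ∀ x ∈ I.X, ∀ i, x i = 0 ∨ x i = 1) (hrec : I.CompleteRecourse)
    (hS0 : I.S0.PosDef) :
    ∃ M₀ : ℝ, 0 < M₀ ∧ ∀ M, M₀ ≤ M → ∀ x ∈ I.X, ∀ Q u α,
      I.IsDualBound (fun s => I.Ψ x (I.ξ s)) Q u α →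
      ∃ z : SDPVars d k m n N, I.SDPFeasible M x z ∧ z.r + z.t = α := by
  have hfin : I.X.Finite := by
    refine (Set.Finite.pi' (t := fun _ : Fin d => ({0, 1} : Set ℝ)) fun _ => by simp).subset ?_
    exact fun x hx i => hX x hx i
  have hM := fun x : I.X => I.exists_sdpFeasible x.2 (hX x x.2) hrec
  choose M hM using hM
  have : Finite I.X := hfin
  obtain ⟨B, hB⟩ := (Set.finite_range M).bddAbove
  refine ⟨max B 1, by positivity, fun M' hM' x hx Q u α hα => ?_⟩
  have e : u = (u - (2 : ℝ) • (Q *ᵥ I.μ0)) + (2 : ℝ) • (Q *ᵥ I.μ0) := by abel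
  rw [e, I.isDualBound_iff hS0] at hα
  obtain ⟨z, hz, hr, ht⟩ := hM ⟨x, hx⟩ M'
    ((hB ⟨⟨x, hx⟩, rfl⟩).trans ((le_max_left _ _).trans hM')) Q _ _ hα.1 hα.2
  exact ⟨z, hz, by rw [hr, ht]; ring⟩

variable {M : ℝ} {x : Fin d → ℝ}

/-- Weak duality between the two programs; it holds for every `M`. -/
theorem SDPFeasible.pessObjective_le {z : SDPVars d k m n N}
    (hx : ∀ i, x i = 0 ∨ x i = 1) (hrec : I.CompleteRecourse) (hS0 : I.S0.PosDef)
    (hγ1 : 0 ≤ I.γ1) (h : I.SDPFeasible M x z) :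
    I.pessObjective x ≤ (I.sdpObjective x z : EReal) := by
  have h1 : (⨆ p ∈ I.ambiguitySet, ((∑ s, p s * I.Ψ x (I.ξ s) : ℝ) : EReal)) ≤
      ((z.r + z.t : ℝ) : EReal) := iSup₂_le fun p hp =>
    EReal.coe_le_coe_iff.2 ((h.isDualBound hx hrec hS0).sum_le hS0 hγ1 hp)
  rw [pessObjective, sdpObjective, add_assoc, EReal.coe_add]
  gcongr

/-- Strong duality between the two programs. The infimum need not be attained. -/
theorem sdpValueAt_eq (hx : ∀ i, x i = 0 ∨ x i = 1) (hrec : I.CompleteRecourse)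
    (hS0 : I.S0.PosDef) (hγ1 : 0 ≤ I.γ1)
    (hM : ∀ Q u α, I.IsDualBound (fun s => I.Ψ x (I.ξ s)) Q u α →
      ∃ z : SDPVars d k m n N, I.SDPFeasible M x z ∧ z.r + z.t = α) :
    I.sdpValueAt M x = I.pessObjective x := by
  refine le_antisymm ?_ (le_iInf₂ fun z hz => hz.pessObjective_le hx hrec hS0 hγ1)
  by_contra! hlt
  obtain ⟨β, hβ₁, hβ₂⟩ := EReal.lt_iff_exists_real_btwn.1 hlt
  have hval : ∀ p ∈ I.ambiguitySet, ∑ s, p s * I.Ψ x (I.ξ s) < β - I.w ⬝ᵥ x := fun p hp => by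
    have h1 : ((I.w ⬝ᵥ x : ℝ) : EReal) + ((∑ s, p s * I.Ψ x (I.ξ s) : ℝ) : EReal) ≤
        I.pessObjective x := by
      rw [pessObjective]
      gcongr
      exact le_iSup₂ (f := fun (p : Fin N → ℝ) (_ : p ∈ I.ambiguitySet) =>
        ((∑ s, p s * I.Ψ x (I.ξ s) : ℝ) : EReal)) p hp
    have h2 := h1.trans_lt hβ₁
    rw [← EReal.coe_add, EReal.coe_lt_coe_iff] at h2
    linarith
  obtain ⟨Q, u, hb⟩ := exists_isDualBound_of_forall_lt hS0 hγ1 hval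
  obtain ⟨z, hz, hrt⟩ := hM Q u _ hb
  have h1 : I.sdpValueAt M x ≤ (I.sdpObjective x z : EReal) := iInf₂_le z hz
  have h2 : I.sdpObjective x z = β := by rw [sdpObjective, add_assoc, hrt]; ring
  rw [h2] at h1
  exact absurd h1 (not_le.2 hβ₂)

end BilevelData

end

theorem theorem4 {d k m n N : ℕ} (I : BilevelData d k m n N)
    (hX : ∀ x ∈ I.X, ∀ i, x i = 0 ∨ x i = 1)
    (hrec : I.CompleteRecourse)
    (hS0 : I.S0.PosDef) (hγ1 : 0 ≤ I.γ1) (hγ2 : 1 ≤ I.γ2) :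
    (∀ x ∈ I.X, ∀ s, IsGreatest ((fun y => I.leaderCost (I.ξ s) ⬝ᵥ y) '' I.Ω x (I.ξ s))
      (I.Ψ x (I.ξ s))) ∧
    (I.IsEmpirical → I.StrictlyFeasible) ∧
    ∃ M₀ : ℝ, 0 < M₀ ∧ ∀ M : ℝ, M₀ ≤ M →
      (∀ x ∈ I.X, I.sdpValueAt M x = I.pessObjective x) ∧
      I.sdpValue M = I.pessValue ∧
      (∀ x z, I.IsSDPOptimal M x z → I.IsPessOptimal x) ∧
      (I.StrictlyFeasible → ∀ x, I.IsPessOptimal x → ∃ z, I.IsSDPOptimal M x z) := by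
  refine ⟨fun x hx s => I.isGreatest_Ψ (hrec x hx s).1 (hrec x hx s).2,
    fun h => h.strictlyFeasible hS0 hγ2, ?_⟩
  obtain ⟨M₀, hM₀, hbig⟩ := I.exists_bigM hX hrec hS0
  refine ⟨M₀, hM₀, fun M hM => ?_⟩
  have hval : ∀ x ∈ I.X, I.sdpValueAt M x = I.pessObjective x := fun x hx =>
    BilevelData.sdpValueAt_eq (hX x hx) hrec hS0 hγ1 (hbig M hM x hx)
  refine ⟨hval, le_antisymm ?_ ?_, ?_, ?_⟩
  · refine le_iInf₂ fun x hx => ?_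
    rw [← hval x hx]
    exact iInf_le (fun x => I.sdpValueAt M x) x
  · refine le_iInf fun x => le_iInf₂ fun z hz => ?_
    exact (iInf₂_le x hz.x_mem).trans
      (hz.pessObjective_le (hX x hz.x_mem) hrec hS0 hγ1)
  · rintro x z ⟨hz, hopt⟩
    refine ⟨hz.x_mem, fun x' hx' => ?_⟩
    refine (hz.pessObjective_le (hX x hz.x_mem) hrec hS0 hγ1).trans ?_
    rw [← hval x' hx']
    exact le_iInf₂ fun z' hz' => EReal.coe_le_coe_iff.2 (hopt x' z' hz')
  · rintro hsl x ⟨hx, hopt⟩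
    obtain ⟨Q, u, α, hb, hmin⟩ := hsl.exists_least_isDualBound hS0 hγ1 fun s => I.Ψ x (I.ξ s)
    obtain ⟨z, hz, hrt⟩ := hbig M hM x hx Q u α hb
    refine ⟨z, hz, fun x' z' hz' => EReal.coe_le_coe_iff.1 ?_⟩
    refine le_trans ?_ ((hopt x' hz'.x_mem).trans
      (hz'.pessObjective_le (hX x' hz'.x_mem) hrec hS0 hγ1))
    rw [← hval x hx]
    refine le_iInf₂ fun z'' hz'' => EReal.coe_le_coe_iff.2 ?_
    have := hmin _ _ _ (hz''.isDualBound (hX x hx) hrec hS0)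
    rw [BilevelData.sdpObjective, BilevelData.sdpObjective, add_assoc, add_assoc, hrt]
    linarith
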